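/- Let $M$ be a compact topological space (not necessarily Hausdorff) and let $\mu$ be a Borel measure on $M$ such that every non-empty open set contains a Borel subset $F$ with $0<\mu(F)<\infty$ (for a $\sigma$-finite, or locally finite, Borel measure this just says that non-empty open sets have positive measure). Let $\mathcal H'$ be a separable complex Hilbert space, and for each $m\in M$ let $A(m)$ be a (possibly unbounded) self-adjoint operator in $\mathcal H'$ with domain $D(A(m))$. Assume that the family is measurable, i.e. $m\mapsto\langle\varphi,(A(m)+i)^{-1}\psi\rangle$ is Borel measurable for all $\varphi,\psi\in\mathcal H'$. Let $A=\int_M^\oplus A(m)\,\mathrm d\mu(m)$ be the fibred operator on $\mathcal H=\int_M^\oplus\mathcal H'\,\mathrm d\mu=L^2(M,\mu;\mathcal H')$, that is, $$D(A)=\Big\{f\in\mathcal H:\ f(m)\in D(A(m))\text{ for }\mu\text{-a.e. }m,\ \ m\mapsto A(m)f(m)\in L^2(M,\mu;\mathcal H')\Big\},\qquad (Af)(m)=A(m)f(m)\ \text{ for }\mu\text{-a.e. }m.$$ Assume that the map $m\mapsto\sigma(A(m))$ from $M$ to the closed subsets of $\mathbb R$ is continuous with respect to the (extended, i.e. $[0,\infty]$-valued)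 Hausdorff distance. Then $$\sigma(A)=\bigcup_{m\in M}\sigma(A(m)).$$ -/

import Mathlib

open MeasureTheory TopologicalSpace

noncomputable section

namespace FibredOperator

section Spectrum

variable {E : Type*} [NormedAddCommGroup E] [NormedSpace ℂ E]

/-- `R` is a bounded two-sided inverse of `T - z : D(T) → E`, where `T` is a (possibly unbounded)
operator with domain `D(T)`. -/
def IsResolventAt (T : E →ₗ.[ℂ] E) (z : ℂ) (R : E →L[ℂ] E) : Prop :=
  (∀ x : T.domain, R (T x - z • (x : E)) = x) ∧
    ∀ y : E, ∃ x : T.domain, (x : E) = R y ∧ T x - z • (x : E) = y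

/-- The resolvent set of a (possibly unbounded) operator. -/
def resolventSet (T : E →ₗ.[ℂ] E) : Set ℂ :=
  {z | ∃ R : E →L[ℂ] E, IsResolventAt T z R}

/-- The spectrum `σ(T) ⊆ ℂ` of a (possibly unbounded) operator. -/
def spectrum (T : E →ₗ.[ℂ] E) : Set ℂ := (resolventSet T)ᶜ

open Classical in
/-- The resolvent `(T - z)⁻¹`; it is set to `0` when `z` lies in the spectrum. -/
def resolvent (T : E →ₗ.[ℂ] E) (z : ℂ) : E →L[ℂ] E :=
  if h : ∃ R : E →L[ℂ] E, IsResolventAt T z R then h.choose else 0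

theorem IsResolventAt.unique {T : E →ₗ.[ℂ] E} {z : ℂ} {R S : E →L[ℂ] E}
    (hR : IsResolventAt T z R) (hS : IsResolventAt T z S) : R = S := by
  ext y
  obtain ⟨x, hx, hxy⟩ := hR.2 y
  rw [← hx, ← hxy, hS.1 x]

theorem IsResolventAt.resolvent_eq {T : E →ₗ.[ℂ] E} {z : ℂ} {R : E →L[ℂ] E}
    (hR : IsResolventAt T z R) : resolvent T z = R := by
  have h : ∃ R : E →L[ℂ] E, IsResolventAt T z R := ⟨R, hR⟩
  rw [resolvent, dif_pos h]
  exact h.choose_spec.unique hR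

theorem isOpen_resolventSet [CompleteSpace E] (T : E →ₗ.[ℂ] E) : IsOpen (resolventSet T) := by
  rw [isOpen_iff_mem_nhds]
  rintro z ⟨R, hR⟩
  have hc : Filter.Tendsto (fun w : ℂ => ‖(w - z) • R‖) (nhds z) (nhds 0) := by
    have : Continuous fun w : ℂ => ‖(w - z) • R‖ := by fun_prop
    simpa using this.tendsto z
  filter_upwards [hc.eventually_lt_const one_pos] with w hw
  obtain ⟨u, hu⟩ := isUnit_one_sub_of_norm_lt_one hw
  have h1 : ∀ y, (↑u⁻¹ : E →L[ℂ] E) (y - (w - z) • R y) = y := fun y => by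
    have := congrArg (fun f : E →L[ℂ] E => f y) u.inv_mul
    simpa [hu] using this
  have h2 : ∀ y, (↑u⁻¹ : E →L[ℂ] E) y - (w - z) • R ((↑u⁻¹ : E →L[ℂ] E) y) = y := fun y => by
    have := congrArg (fun f : E →L[ℂ] E => f y) u.mul_inv
    simpa [hu] using this
  refine ⟨R.comp (↑u⁻¹ : E →L[ℂ] E), fun x => ?_, fun y => ?_⟩
  · have hx := hR.1 x
    have : T x - w • (x : E) =
        (T x - z • (x : E)) - (w - z) • R (T x - z • (x : E)) := by
      rw [hx]; module
    rw [this, ContinuousLinearMap.comp_apply, h1, hx]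
  · obtain ⟨x, hx, hxy⟩ := hR.2 ((↑u⁻¹ : E →L[ℂ] E) y)
    refine ⟨x, hx, ?_⟩
    have : T x - w • (x : E) = (T x - z • (x : E)) - (w - z) • (x : E) := by module
    rw [this, hxy, hx, h2]

/-- The real points `σ(T) ∩ ℝ` of the spectrum (all of `σ(T)` if `T` is self-adjoint), as an element
of the space of closed subsets of `ℝ`. Mathlib's (extended) metric on `Closeds ℝ` is the Hausdorff
distance. -/
def realSpectrum [CompleteSpace E] (T : E →ₗ.[ℂ] E) : Closeds ℝ where
  carrier := {x : ℝ | (x : ℂ) ∈ spectrum T}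
  isClosed' := (isOpen_resolventSet T).isClosed_compl.preimage Complex.continuous_ofReal

end Spectrum

section DirectIntegral

variable {H : Type*} [NormedAddCommGroup H] [InnerProductSpace ℂ H]
variable {M : Type*} [MeasurableSpace M]

/-- Measurability of a family of (unbounded) self-adjoint operators on `H`: the bounded operators
`(A(m) + i)⁻¹` depend weakly measurably on `m`. -/
def MeasurableFamily (A : M → H →ₗ.[ℂ] H) : Prop :=
  ∀ φ ψ : H, Measurable fun m => inner ℂ φ (resolvent (A m) (-Complex.I) ψ)

/-- The pairs `(f, g)` in `L²(M, μ; H) × L²(M, μ; H)` such that for `μ`-almost every `m`,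
`f(m) ∈ D(A(m))` and `A(m) f(m) = g(m)`. -/
def directIntegralGraph (μ : Measure M) (A : M → H →ₗ.[ℂ] H) :
    Submodule ℂ (Lp H 2 μ × Lp H 2 μ) where
  carrier := {p | ∀ᵐ m ∂μ, (p.1 m, p.2 m) ∈ (A m).graph}
  zero_mem' := by
    filter_upwards [Lp.coeFn_zero H 2 μ] with m hm
    change ((0 : Lp H 2 μ) m, (0 : Lp H 2 μ) m) ∈ (A m).graph
    rw [hm]
    exact (A m).graph.zero_mem
  add_mem' := by
    intro p q hp hq
    filter_upwards [hp, hq, Lp.coeFn_add p.1 q.1, Lp.coeFn_add p.2 q.2] with m h1 h2 h3 h4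
    change ((p.1 + q.1) m, (p.2 + q.2) m) ∈ (A m).graph
    rw [h3, h4]
    exact (A m).graph.add_mem h1 h2
  smul_mem' := by
    intro c p hp
    filter_upwards [hp, Lp.coeFn_smul c p.1, Lp.coeFn_smul c p.2] with m h1 h2 h3
    change ((c • p.1) m, (c • p.2) m) ∈ (A m).graph
    rw [h2, h3]
    exact (A m).graph.smul_mem c h1

/-- The fibred operator `A = ∫^⊕ A(m) dμ(m)` on the constant fibre direct integral
`∫^⊕ H dμ = L²(M, μ; H)`. Its domain consists of the `f` with `f(m) ∈ D(A(m))` for almost every `m`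
and `m ↦ A(m) f(m)` in `L²`, and `(A f)(m) = A(m) f(m)`; see `mem_graph_directIntegral`. -/
def directIntegral (μ : Measure M) (A : M → H →ₗ.[ℂ] H) : Lp H 2 μ →ₗ.[ℂ] Lp H 2 μ :=
  (directIntegralGraph μ A).toLinearPMap

theorem mem_graph_directIntegral (μ : Measure M) (A : M → H →ₗ.[ℂ] H) (f g : Lp H 2 μ) :
    (f, g) ∈ (directIntegral μ A).graph ↔ ∀ᵐ m ∂μ, ∃ x : (A m).domain, (x : H) = f m ∧
      A m x = g m := by
  have key : (directIntegral μ A).graph = directIntegralGraph μ A := by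
    refine Submodule.toLinearPMap_graph_eq _ fun p hp hp0 => ?_
    refine Lp.ext ?_
    filter_upwards [hp, Lp.coeFn_zero H 2 μ] with m hm h0
    rw [hp0] at hm
    rw [h0] at hm ⊢
    exact (A m).graph_fst_eq_zero_snd hm rfl
  rw [key]
  change (∀ᵐ m ∂μ, (f m, g m) ∈ (A m).graph) ↔ _
  simp only [LinearPMap.mem_graph_iff]

end DirectIntegral

end FibredOperator

end

/-! Both inclusions rest on lower bounds for A(m) - z. Suppose z lies in no fibre spectrum. If z is
not real, then ‖(A(m) - z)x‖ ≥ |Im z| ‖x‖. If z is real, its distance to σ(A(m)) is a continuous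
positive function on the compact space M, hence at least some d > 0, and self-adjointness gives
‖(A(m) - z)x‖ ≥ d ‖x‖ (`mul_norm_le_of_forall_le_abs_sub`). Such a bound, uniform in m, puts z in
the resolvent set of A (`mem_resolventSet_directIntegral`): R = (A + i)⁻¹ acts fibrewise and is
normal, so (A - z)R = 1 + (-i - z)R is normal and bounded below, hence invertible. Self-adjointness
of A itself is not needed.

Conversely, if l ∈ σ(A(m₀)), continuity gives an open set of m for which σ(A(m)) comes close to l,
and it contains some F with 0 < μ(F) < ∞. Each fibre over F has approximate eigenvectors, which may
be taken of the form R(m)v with v in a countable dense set. One v therefore serves on a set G of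
positive measure, and R(1_G v) is an approximate eigenvector of A (`mem_spectrum_directIntegral`).
-/

namespace FibredOperator

/-! ### Lower bounds and resolvents of a self-adjoint operator -/

section SelfAdjoint

variable {H : Type*} [NormedAddCommGroup H] [InnerProductSpace ℂ H] [CompleteSpace H]
  {A : H →ₗ.[ℂ] H}

theorem inner_map_left_of_isSelfAdjoint (hA : IsSelfAdjoint A) (x y : A.domain) :
    inner ℂ (A x) (y : H) = inner ℂ (x : H) (A y) := by
  have h := A.adjoint_isFormalAdjoint hA.dense_domain
  rw [LinearPMap.isSelfAdjoint_def.1 hA] at h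
  exact h x y

theorem mem_graph_of_forall_inner (hA : IsSelfAdjoint A) {y w : H}
    (h : ∀ x : A.domain, inner ℂ w (x : H) = inner ℂ y (A x)) : (y, w) ∈ A.graph := by
  have hy : y ∈ A.adjoint.domain := A.mem_adjoint_domain_of_exists y ⟨w, h⟩
  have h2 : A.adjoint ⟨y, hy⟩ = w :=
    LinearPMap.adjoint_apply_eq hA.dense_domain ⟨y, hy⟩ h
  have h3 : (y, w) ∈ A.adjoint.graph := by
    rw [LinearPMap.mem_graph_iff]
    exact ⟨⟨y, hy⟩, rfl, h2⟩
  rwa [LinearPMap.isSelfAdjoint_def.1 hA] at h3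

theorem inner_self_map_im_eq_zero (hA : IsSelfAdjoint A) (x : A.domain) :
    (inner ℂ (x : H) (A x)).im = 0 := by
  have h := inner_conj_symm (𝕜 := ℂ) (A x) (x : H)
  rw [inner_map_left_of_isSelfAdjoint hA x x] at h
  exact Complex.conj_eq_iff_im.1 h

/-- Since ⟨Ax, x⟩ is real, the expanded square depends on z only through Re z and |z|. -/
theorem norm_sub_conj_smul (hA : IsSelfAdjoint A) (z : ℂ) (x : A.domain) :
    ‖A x - (starRingEnd ℂ) z • (x : H)‖ = ‖A x - z • (x : H)‖ := by
  have h : (inner ℂ (A x) (x : H)).im = 0 := by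
    rw [inner_map_left_of_isSelfAdjoint hA]
    exact inner_self_map_im_eq_zero hA x
  have key : ‖A x - (starRingEnd ℂ) z • (x : H)‖ ^ 2 = ‖A x - z • (x : H)‖ ^ 2 := by
    rw [@norm_sub_sq ℂ, @norm_sub_sq ℂ]
    simp [inner_smul_right, norm_smul, h]
  exact (sq_eq_sq₀ (norm_nonneg _) (norm_nonneg _)).1 key

/-- Cauchy–Schwarz applied to Im ⟨x, (A - z)x⟩ = -(Im z) ‖x‖². -/
theorem abs_im_mul_norm_le (hA : IsSelfAdjoint A) (z : ℂ) (x : A.domain) :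
    |z.im| * ‖(x : H)‖ ≤ ‖A x - z • (x : H)‖ := by
  have h1 : (inner ℂ (x : H) (A x - z • (x : H))).im = -(z.im * ‖(x : H)‖ ^ 2) := by
    rw [inner_sub_right, inner_smul_right, Complex.sub_im, inner_self_map_im_eq_zero hA,
      inner_self_eq_norm_sq_to_K]
    simp [← Complex.ofReal_pow]
  have h2 : |z.im| * ‖(x : H)‖ ^ 2 ≤ ‖(x : H)‖ * ‖A x - z • (x : H)‖ := by
    calc |z.im| * ‖(x : H)‖ ^ 2 = |(inner ℂ (x : H) (A x - z • (x : H))).im| := by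
          rw [h1, abs_neg, abs_mul, abs_of_nonneg (sq_nonneg ‖(x : H)‖)]
      _ ≤ ‖inner ℂ (x : H) (A x - z • (x : H))‖ := Complex.abs_im_le_norm _
      _ ≤ _ := norm_inner_le_norm _ _
  rcases eq_or_lt_of_le (norm_nonneg (x : H)) with h0 | h0
  · rw [← h0]; simp
  · refine le_of_mul_le_mul_left ?_ h0
    calc _ = |z.im| * ‖(x : H)‖ ^ 2 := by ring
      _ ≤ _ := h2

/-- A self-adjoint operator `A` with `A - z` bounded below has a bounded resolvent at `z`. -/
theorem exists_isResolventAt_of_bounded_below (hA : IsSelfAdjoint A) {z : ℂ} {c : ℝ} (hc : 0 < c)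
    (h : ∀ x : A.domain, c * ‖(x : H)‖ ≤ ‖A x - z • (x : H)‖) :
    ∃ R : H →L[ℂ] H, IsResolventAt A z R ∧ ‖R‖ ≤ c⁻¹ := by
  let L : A.domain →ₗ[ℂ] H := A.toFun - z • A.domain.subtype
  have hL : ∀ x, L x = A x - z • (x : H) := fun x => rfl
  have hinj : Function.Injective L := by
    rw [← LinearMap.ker_eq_bot, LinearMap.ker_eq_bot']
    intro x hx
    have := h x
    rw [← hL, hx, norm_zero] at this
    have h0 : ‖(x : H)‖ = 0 := by
      have := norm_nonneg (x : H)
      nlinarith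
    exact Subtype.ext (norm_eq_zero.1 h0)
  -- The lower bound makes preimages of a convergent sequence Cauchy; the graph of A is closed.
  have hclosed : IsClosed (LinearMap.range L : Set H) := by
    refine isClosed_of_closure_subset fun y hy => ?_
    obtain ⟨u, hu, hlim⟩ := mem_closure_iff_seq_limit.1 hy
    choose v hv using hu
    have hcauchy : CauchySeq fun n => (v n : H) := by
      rw [Metric.cauchySeq_iff]
      intro ε hε
      obtain ⟨N, hN⟩ := Metric.cauchySeq_iff.1 hlim.cauchySeq (c * ε) (by positivity)
      refine ⟨N, fun m hm n hn => ?_⟩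
      have h1 := hN m hm n hn
      have h2 := h (v m - v n)
      rw [← hL, map_sub, hv, hv, ← dist_eq_norm] at h2
      have h3 : c * dist (v m : H) (v n) < c * ε := by
        rw [dist_eq_norm]
        exact lt_of_le_of_lt h2 h1
      exact lt_of_mul_lt_mul_left h3 hc.le
    obtain ⟨x, hx⟩ := cauchySeq_tendsto_of_complete hcauchy
    have hgr : (x, y + z • x) ∈ A.graph := by
      have hcl : IsClosed (A.graph : Set (H × H)) := hA.isClosed
      refine hcl.mem_of_tendsto
        (hx.prodMk_nhds (hlim.add (hx.const_smul z))) (Filter.Eventually.of_forall fun n => ?_)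
      change ((v n : H), u n + z • (v n : H)) ∈ A.graph
      rw [LinearPMap.mem_graph_iff]
      refine ⟨v n, rfl, ?_⟩
      rw [← hv, hL, sub_add_cancel]
    rw [LinearPMap.mem_graph_iff] at hgr
    obtain ⟨x', hx', hAx⟩ := hgr
    refine ⟨x', ?_⟩
    simp only at hx' hAx
    rw [hL, hAx, hx', add_sub_cancel_right]
  have hsurj : Function.Surjective L := by
    rw [← LinearMap.range_eq_top]
    have : CompleteSpace (LinearMap.range L) := hclosed.completeSpace_coe
    rw [← Submodule.orthogonal_eq_bot_iff, Submodule.eq_bot_iff]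
    intro y hy
    -- A vector orthogonal to the range of A - z lies in ker(A - z̄), where the same lower bound
    -- forces it to vanish.
    have hgr : (y, (starRingEnd ℂ) z • y) ∈ A.graph := by
      refine mem_graph_of_forall_inner hA fun x => ?_
      have h0 : inner ℂ y (L x) = 0 := Submodule.inner_left_of_mem_orthogonal (L.mem_range_self x) hy
      rw [hL, inner_sub_right, sub_eq_zero, inner_smul_right] at h0
      rw [h0, inner_smul_left, Complex.conj_conj]
    rw [LinearPMap.mem_graph_iff] at hgr
    obtain ⟨x, hx, hAx⟩ := hgr
    simp only at hx hAx
    have h1 := h x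
    rw [← norm_sub_conj_smul hA, hAx, hx, sub_self, norm_zero] at h1
    have := norm_nonneg y
    exact norm_eq_zero.1 (by nlinarith)
  let e := LinearEquiv.ofBijective L ⟨hinj, hsurj⟩
  have hbound : ∀ y, ‖(A.domain.subtype ∘ₗ e.symm.toLinearMap) y‖ ≤ c⁻¹ * ‖y‖ := by
    intro y
    have h1 := h (e.symm y)
    rw [← hL, show L (e.symm y) = y from e.apply_symm_apply y] at h1
    rw [inv_mul_eq_div, le_div_iff₀ hc, mul_comm]
    exact h1
  refine ⟨LinearMap.mkContinuous _ c⁻¹ hbound, ⟨fun x => ?_, fun y => ?_⟩,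
    LinearMap.mkContinuous_norm_le _ (inv_nonneg.2 hc.le) _⟩
  · change ((e.symm (L x) : A.domain) : H) = x
    congr 1
    exact e.symm_apply_apply x
  · exact ⟨e.symm y, rfl, e.apply_symm_apply y⟩

theorem mem_resolventSet_of_im_ne_zero (hA : IsSelfAdjoint A) {z : ℂ} (hz : z.im ≠ 0) :
    z ∈ resolventSet A := by
  obtain ⟨R, hR, -⟩ :=
    exists_isResolventAt_of_bounded_below hA (abs_pos.2 hz) (abs_im_mul_norm_le hA z)
  exact ⟨R, hR⟩

/-- The first resolvent identity. -/
theorem IsResolventAt.sub_eq {E : Type*} [NormedAddCommGroup E] [NormedSpace ℂ E]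
    {T : E →ₗ.[ℂ] E} {z w : ℂ} {R S : E →L[ℂ] E}
    (hR : IsResolventAt T z R) (hS : IsResolventAt T w S) : R - S = (z - w) • (R * S) := by
  ext y
  obtain ⟨x, hx, hxy⟩ := hS.2 y
  have h : y = (T x - z • (x : E)) + (z - w) • (x : E) := by rw [← hxy]; module
  have h2 : R y = S y + (z - w) • R (S y) := by
    conv_lhs => rw [h, map_add, hR.1 x, map_smul, hx]
  simp [h2]

theorem IsResolventAt.adjoint_eq (hA : IsSelfAdjoint A) {z : ℂ} {R S : H →L[ℂ] H}
    (hR : IsResolventAt A z R) (hS : IsResolventAt A ((starRingEnd ℂ) z) S) :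
    star R = S := by
  symm
  refine (ContinuousLinearMap.eq_adjoint_iff S R).2 fun x y => ?_
  obtain ⟨u, hu, rfl⟩ := hS.2 x
  obtain ⟨v, hv, rfl⟩ := hR.2 y
  rw [← hu, ← hv, inner_sub_left, inner_sub_right, inner_smul_left, inner_smul_right,
    Complex.conj_conj, inner_map_left_of_isSelfAdjoint hA]

theorem isResolventAt_neg_I (hA : IsSelfAdjoint A) :
    IsResolventAt A (-Complex.I) (resolvent A (-Complex.I)) := by
  obtain ⟨R, hR⟩ := mem_resolventSet_of_im_ne_zero hA (z := -Complex.I) (by simp)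
  rwa [hR.resolvent_eq]

theorem norm_resolvent_neg_I_le (hA : IsSelfAdjoint A) : ‖resolvent A (-Complex.I)‖ ≤ 1 := by
  obtain ⟨R, hR, h⟩ := exists_isResolventAt_of_bounded_below hA (z := -Complex.I) one_pos
    (fun x => by simpa using abs_im_mul_norm_le hA (-Complex.I) x)
  rw [hR.resolvent_eq]
  simpa using h

/-- The adjoint is the resolvent at i, and the resolvent identity written in both orders makes the
two commute. -/
theorem isStarNormal_resolvent_neg_I (hA : IsSelfAdjoint A) :
    IsStarNormal (resolvent A (-Complex.I)) := by
  have hR := isResolventAt_neg_I hA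
  obtain ⟨S, hS⟩ := mem_resolventSet_of_im_ne_zero hA (z := Complex.I) (by simp)
  refine ⟨?_⟩
  rw [hR.adjoint_eq hA (S := S) (by simpa using hS)]
  have h1 := hR.sub_eq hS
  have h2 := hS.sub_eq hR
  have h3 : (-Complex.I - Complex.I) • (S * resolvent A (-Complex.I)) =
      (-Complex.I - Complex.I) • (resolvent A (-Complex.I) * S) := by
    rw [← h1, ← neg_sub S, h2, ← neg_smul]
    congr 1
    ring
  exact smul_right_injective _ (by simp [Complex.ext_iff]; norm_num) h3

/-- If the real spectrum of a self-adjoint operator `A` has distance at least `d` from the point `l`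
of the resolvent set, then `A - l` is bounded below by `d`. -/
theorem mul_norm_le_of_forall_le_abs_sub (hA : IsSelfAdjoint A) {l d : ℝ} (hd : 0 < d)
    (hl : (l : ℂ) ∈ resolventSet A) (h : ∀ s : ℝ, (s : ℂ) ∈ spectrum A → d ≤ |s - l|)
    (x : A.domain) : d * ‖(x : H)‖ ≤ ‖A x - (l : ℂ) • (x : H)‖ := by
  obtain ⟨B, hB⟩ := hl
  have hBsa : IsSelfAdjoint B := hB.adjoint_eq hA (S := B) (by simpa using hB)
  have hxB := hB.1 x
  rcases subsingleton_or_nontrivial H with hH | hH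
  · simp [Subsingleton.elim (x : H) 0]
  have hnorm : ‖B‖ ≤ d⁻¹ := by
    -- B = (A - l)⁻¹ is self-adjoint, so its norm is attained by some |k| with k in its spectrum. A
    -- nonzero such k yields the point l + 1/k of σ(A), whence 1/|k| ≥ d.
    obtain ⟨k, hk, hkn⟩ := _root_.spectrum.exists_nnnorm_eq_spectralRadius B
    rw [hBsa.spectralRadius_eq_nnnorm] at hkn
    have hkn' : ‖k‖ = ‖B‖ := by
      have := ENNReal.coe_injective hkn
      exact congrArg NNReal.toReal this
    rcases eq_or_ne k 0 with hk0 | hk0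
    · rw [← hkn', hk0, norm_zero]; positivity
    have hw : (l : ℂ) + k⁻¹ ∈ spectrum A := by
      rintro ⟨S, hS⟩
      apply hk
      have h1 := hB.sub_eq hS
      have h2 := hS.sub_eq hB
      rw [show (l : ℂ) - (l + k⁻¹) = -k⁻¹ by ring] at h1
      rw [show (l : ℂ) + k⁻¹ - l = k⁻¹ by ring] at h2
      have e1 : B * S = k • (S - B) := by
        rw [← neg_sub B S, h1, neg_smul, neg_neg, smul_smul, mul_inv_cancel₀ hk0, one_smul]
      have e2 : S * B = k • (S - B) := by
        rw [h2, smul_smul, mul_inv_cancel₀ hk0, one_smul]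
      rw [_root_.spectrum.mem_resolventSet_iff]
      -- With w = l + 1/k and S = (A - w)⁻¹, one has k - B = k(A - w)B, whose inverse is k⁻¹(A - l)S
      -- = k⁻¹(1 + k⁻¹S).
      have e3 : (algebraMap ℂ (H →L[ℂ] H) k - B) * (k⁻¹ • (1 + k⁻¹ • S)) = 1 := by
        rw [Algebra.algebraMap_eq_smul_one]
        simp only [mul_smul_comm, sub_mul, mul_add, smul_mul_assoc, one_mul, mul_one, e1]
        match_scalars <;> field_simp <;> ring
      have e4 : (k⁻¹ • (1 + k⁻¹ • S)) * (algebraMap ℂ (H →L[ℂ] H) k - B) = 1 := by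
        rw [Algebra.algebraMap_eq_smul_one]
        simp only [mul_smul_comm, mul_sub, add_mul, smul_mul_assoc, one_mul, mul_one, e2]
        match_scalars <;> field_simp <;> ring
      exact ⟨⟨_, _, e3, e4⟩, rfl⟩
    have him : ((l : ℂ) + k⁻¹).im = 0 := by
      by_contra hne
      exact hw (mem_resolventSet_of_im_ne_zero hA hne)
    have hre : ((((l : ℂ) + k⁻¹).re : ℝ) : ℂ) = (l : ℂ) + k⁻¹ :=
      Complex.ext (by simp) (by simpa using him.symm)
    have h1 := h _ (hre ▸ hw)
    have h2 : |((l : ℂ) + k⁻¹).re - l| = ‖k‖⁻¹ := by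
      rw [← Real.norm_eq_abs, ← Complex.norm_real, Complex.ofReal_sub, hre, add_sub_cancel_left, norm_inv]
    rw [h2, hkn'] at h1
    rw [← inv_inv ‖B‖]
    exact inv_anti₀ hd h1
  calc d * ‖(x : H)‖ = d * ‖B (A x - (l : ℂ) • (x : H))‖ := by rw [hxB]
    _ ≤ d * (d⁻¹ * ‖A x - (l : ℂ) • (x : H)‖) := by
        gcongr
        exact B.le_of_opNorm_le hnorm _
    _ = _ := by rw [← mul_assoc, mul_inv_cancel₀ hd.ne', one_mul]

/-- Weyl's criterion: points of the spectrum of a self-adjoint operator are approximate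
eigenvalues. -/
theorem exists_norm_sub_smul_lt (hA : IsSelfAdjoint A) {z : ℂ} (hz : z ∈ spectrum A) {ε : ℝ}
    (hε : 0 < ε) : ∃ x : A.domain, ‖A x - z • (x : H)‖ < ε * ‖(x : H)‖ := by
  by_contra! h
  obtain ⟨R, hR, -⟩ := exists_isResolventAt_of_bounded_below hA hε h
  exact hz ⟨R, hR⟩

/-- For normal T the orthogonal complement of the range is ker T, which the lower bound makes
trivial; the bound also closes the range. -/
theorem isUnit_of_isStarNormal_of_bounded_below {T : H →L[ℂ] H} (hT : IsStarNormal T) {c : ℝ}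
    (hc : 0 < c) (h : ∀ x, c * ‖x‖ ≤ ‖T x‖) : IsUnit T := by
  have hanti : AntilipschitzWith (Real.toNNReal c⁻¹) T := by
    refine AddMonoidHomClass.antilipschitz_of_bound T fun x => ?_
    rw [Real.coe_toNNReal _ (inv_nonneg.2 hc.le), inv_mul_eq_div, le_div_iff₀ hc, mul_comm]
    exact h x
  rw [ContinuousLinearMap.isUnit_iff_bijective,
    ContinuousLinearMap.bijective_iff_dense_range_and_antilipschitz]
  refine ⟨?_, _, hanti⟩
  rw [Submodule.topologicalClosure_eq_top_iff, ContinuousLinearMap.IsStarNormal.orthogonal_range hT]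
  exact LinearMap.ker_eq_bot.2 hanti.injective

end SelfAdjoint

end FibredOperator

noncomputable section

namespace FibredOperator

/-! ### Weak measurability in a separable space -/

section Measurability

theorem measurable_inner_star {H : Type*} [NormedAddCommGroup H]
    [InnerProductSpace ℂ H] [CompleteSpace H] {M : Type*} [MeasurableSpace M] {T : M → H →L[ℂ] H}
    (hT : ∀ φ ψ : H, Measurable fun m => inner ℂ φ (T m ψ)) (φ ψ : H) :
    Measurable fun m => inner ℂ φ ((star (T m)) ψ) := by
  have h : (fun m => inner ℂ φ ((star (T m)) ψ)) =
      fun m => (starRingEnd ℂ) (inner ℂ ψ (T m φ)) := by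
    ext m
    rw [ContinuousLinearMap.star_eq_adjoint, ContinuousLinearMap.adjoint_inner_right,
      inner_conj_symm]
  rw [h]
  exact Complex.continuous_conj.measurable.comp (hT ψ φ)

variable {H : Type*} [NormedAddCommGroup H] [InnerProductSpace ℂ H] [SeparableSpace H]
  {M : Type*} [MeasurableSpace M]

/-- For r ≥ 0, ‖f(m)‖ > r exactly when r‖v‖ < |⟨v, f(m)⟩| for some v in a dense sequence: the
condition is open in v and holds at v = f(m). -/
theorem measurable_norm_of_measurable_inner {f : M → H}
    (hf : ∀ φ : H, Measurable fun m => inner ℂ φ (f m)) : Measurable fun m => ‖f m‖ := by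
  refine measurable_of_Ioi fun r => ?_
  rcases lt_or_ge r 0 with hr | hr
  · convert MeasurableSet.univ
    ext m
    simpa using lt_of_lt_of_le hr (norm_nonneg (f m))
  have h : (fun m => ‖f m‖) ⁻¹' Set.Ioi r =
      ⋃ n, {m | r * ‖denseSeq H n‖ < ‖inner ℂ (denseSeq H n) (f m)‖} := by
    ext m
    simp only [Set.mem_preimage, Set.mem_Ioi, Set.mem_iUnion, Set.mem_ofPred_eq]
    constructor
    · intro hm
      have hopen : IsOpen {v : H | r * ‖v‖ < ‖inner ℂ v (f m)‖} :=
        isOpen_lt (by fun_prop) (by fun_prop)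
      have hmem : f m ∈ {v : H | r * ‖v‖ < ‖inner ℂ v (f m)‖} := by
        have : (0 : ℝ) < ‖f m‖ := hr.trans_lt hm
        simp only [Set.mem_ofPred_eq, inner_self_eq_norm_sq_to_K, norm_pow, RCLike.norm_ofReal,
          abs_norm]
        nlinarith
      exact (denseRange_denseSeq H).exists_mem_open hopen ⟨_, hmem⟩
    · rintro ⟨n, hn⟩
      have h1 := norm_inner_le_norm (𝕜 := ℂ) (denseSeq H n) (f m)
      by_contra! h2
      have := mul_le_mul_of_nonneg_left h2 (norm_nonneg (denseSeq H n))
      nlinarith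
  rw [h]
  exact MeasurableSet.iUnion fun n => measurableSet_lt measurable_const (hf _).norm

/-- Weakly measurable functions into a separable inner product space are measurable. -/
theorem measurable_of_measurable_inner [MeasurableSpace H] [BorelSpace H] {f : M → H}
    (hf : ∀ φ : H, Measurable fun m => inner ℂ φ (f m)) : Measurable f := by
  have : SecondCountableTopology H := UniformSpace.secondCountable_of_separable H
  have hball : ∀ (c : H) (r : ℝ), MeasurableSet (f ⁻¹' Metric.ball c r) := fun c r => by
    have h : Measurable fun m => ‖f m - c‖ := measurable_norm_of_measurable_inner fun φ => by
      simp only [inner_sub_right]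
      exact (hf φ).sub measurable_const
    have h2 : f ⁻¹' Metric.ball c r = {m | ‖f m - c‖ < r} := by
      ext m
      simp [dist_eq_norm]
    rw [h2]
    exact measurableSet_lt h measurable_const
  let B : Set (Set H) := {s | ∃ (c : H) (r : ℝ), s = Metric.ball c r}
  have hB : IsTopologicalBasis B := by
    refine isTopologicalBasis_of_isOpen_of_nhds ?_ fun a u ha hu => ?_
    · rintro _ ⟨c, r, rfl⟩
      exact Metric.isOpen_ball
    · obtain ⟨r, hr, hru⟩ := Metric.isOpen_iff.1 hu a ha
      exact ⟨_, ⟨a, r, rfl⟩, Metric.mem_ball_self hr, hru⟩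
  rw [(BorelSpace.measurable_eq (α := H)).trans hB.borel_eq_generateFrom]
  refine measurable_generateFrom ?_
  rintro _ ⟨c, r, rfl⟩
  exact hball c r

/-- A bounded weakly measurable family of bounded operators maps strongly measurable functions to
strongly measurable functions. -/
theorem aestronglyMeasurable_apply_of_measurable_inner {T : M → H →L[ℂ] H}
    (hT : ∀ φ ψ : H, Measurable fun m => inner ℂ φ (T m ψ)) {μ : Measure M} {f : M → H}
    (hf : AEStronglyMeasurable f μ) : AEStronglyMeasurable (fun m => T m (f m)) μ := by
  borelize H
  have : SecondCountableTopology H := UniformSpace.secondCountable_of_separable H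
  have h : Measurable (Function.uncurry fun (v : H) m => T m v) :=
    measurable_uncurry_of_continuous_of_measurable (fun m => (T m).continuous)
      fun v => measurable_of_measurable_inner fun φ => hT φ v
  exact (h.comp_aemeasurable (hf.aemeasurable.prodMk aemeasurable_id)).aestronglyMeasurable

end Measurability

/-! ### Fibrewise bounded operators on L² -/

section Fiberwise

variable {H : Type*} [NormedAddCommGroup H] [InnerProductSpace ℂ H] [SeparableSpace H]
  {M : Type*} [MeasurableSpace M] (μ : Measure M)

theorem memLp_apply_of_measurable_inner {T : M → H →L[ℂ] H}
    (hT : ∀ φ ψ : H, Measurable fun m => inner ℂ φ (T m ψ)) (hC : ∀ m, ‖T m‖ ≤ 1) (f : Lp H 2 μ) :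
    MemLp (fun m => T m (f m)) 2 μ :=
  (Lp.memLp f).of_le (aestronglyMeasurable_apply_of_measurable_inner hT (Lp.memLp f).1)
    (Filter.Eventually.of_forall fun m => by simpa using (T m).le_of_opNorm_le (hC m) (f m))

/-- The operator on `L²(M, μ; H)` acting fibrewise by a weakly measurable family of contractions. -/
def fiberwise (T : M → H →L[ℂ] H) (hT : ∀ φ ψ : H, Measurable fun m => inner ℂ φ (T m ψ))
    (hC : ∀ m, ‖T m‖ ≤ 1) : Lp H 2 μ →L[ℂ] Lp H 2 μ :=
  LinearMap.mkContinuous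
    { toFun := fun f => (memLp_apply_of_measurable_inner μ hT hC f).toLp _
      map_add' := fun f g => by
        refine Lp.ext ?_
        filter_upwards [(memLp_apply_of_measurable_inner μ hT hC (f + g)).coeFn_toLp,
          (memLp_apply_of_measurable_inner μ hT hC f).coeFn_toLp,
          (memLp_apply_of_measurable_inner μ hT hC g).coeFn_toLp, Lp.coeFn_add f g,
          Lp.coeFn_add ((memLp_apply_of_measurable_inner μ hT hC f).toLp _)
            ((memLp_apply_of_measurable_inner μ hT hC g).toLp _)] with m h1 h2 h3 h4 h5
        rw [h1, h5, Pi.add_apply, h2, h3, h4, Pi.add_apply, map_add]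
      map_smul' := fun c f => by
        refine Lp.ext ?_
        filter_upwards [(memLp_apply_of_measurable_inner μ hT hC (c • f)).coeFn_toLp,
          (memLp_apply_of_measurable_inner μ hT hC f).coeFn_toLp, Lp.coeFn_smul c f,
          Lp.coeFn_smul c ((memLp_apply_of_measurable_inner μ hT hC f).toLp _)] with m h1 h2 h3 h4
        rw [h1, RingHom.id_apply, h4, Pi.smul_apply, h2, h3, Pi.smul_apply, map_smul] }
    1 fun f => by
      refine Lp.norm_le_mul_norm_of_ae_le_mul ?_
      filter_upwards [(memLp_apply_of_measurable_inner μ hT hC f).coeFn_toLp] with m h1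
      change ‖(memLp_apply_of_measurable_inner μ hT hC f).toLp _ m‖ ≤ _
      rw [h1]
      exact (T m).le_of_opNorm_le (hC m) (f m)

variable {T : M → H →L[ℂ] H} (hT : ∀ φ ψ : H, Measurable fun m => inner ℂ φ (T m ψ))
  (hC : ∀ m, ‖T m‖ ≤ 1)

theorem fiberwise_apply_ae (f : Lp H 2 μ) : ∀ᵐ m ∂μ, fiberwise μ T hT hC f m = T m (f m) :=
  (memLp_apply_of_measurable_inner μ hT hC f).coeFn_toLp

theorem star_fiberwise [CompleteSpace H] :
    star (fiberwise μ T hT hC) = fiberwise μ (fun m => star (T m)) (measurable_inner_star hT)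
      (fun m => (norm_star (T m)).trans_le (hC m)) := by
  symm
  refine (ContinuousLinearMap.eq_adjoint_iff _ _).2 fun f g => ?_
  rw [L2.inner_def, L2.inner_def]
  refine integral_congr_ae ?_
  filter_upwards [fiberwise_apply_ae μ hT hC g, fiberwise_apply_ae μ (measurable_inner_star hT)
    (fun m => (norm_star (T m)).trans_le (hC m)) f] with m h1 h2
  rw [h1, h2, ContinuousLinearMap.star_eq_adjoint, ContinuousLinearMap.adjoint_inner_left]

theorem isStarNormal_fiberwise [CompleteSpace H] (hN : ∀ m, IsStarNormal (T m)) :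
    IsStarNormal (fiberwise μ T hT hC) := by
  refine ⟨?_⟩
  rw [star_fiberwise]
  set S := fiberwise μ (fun m => star (T m)) (measurable_inner_star hT)
      (fun m => (norm_star (T m)).trans_le (hC m))
  have hS : ∀ f, ∀ᵐ m ∂μ, S f m = star (T m) (f m) := fiberwise_apply_ae μ _ _
  change S * fiberwise μ T hT hC = fiberwise μ T hT hC * S
  ext1 f
  refine Lp.ext ?_
  filter_upwards [hS f, hS (fiberwise μ T hT hC f), fiberwise_apply_ae μ hT hC f,
    fiberwise_apply_ae μ hT hC (S f)] with m h1 h2 h3 h4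
  change S (fiberwise μ T hT hC f) m = fiberwise μ T hT hC (S f) m
  rw [h2, h4, h1, h3]
  exact congrArg (fun B : H →L[ℂ] H => B (f m)) (hN m).star_comm_self

end Fiberwise

/-! ### Resolvent set and spectrum of the direct integral -/

section Spectrum

variable {H : Type*} [NormedAddCommGroup H] [InnerProductSpace ℂ H] [CompleteSpace H]
  [SeparableSpace H] {M : Type*} [MeasurableSpace M] (μ : Measure M)
  {A : M → H →ₗ.[ℂ] H} (hA : ∀ m, IsSelfAdjoint (A m)) (hAmeas : MeasurableFamily A)

/-- The resolvent `(∫^⊕ A(m) dμ(m) + i)⁻¹`, acting fibrewise. -/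
def fiberwiseResolvent : Lp H 2 μ →L[ℂ] Lp H 2 μ :=
  fiberwise μ (fun m => resolvent (A m) (-Complex.I)) hAmeas
    fun m => norm_resolvent_neg_I_le (hA m)

theorem fiberwiseResolvent_apply_ae (f : Lp H 2 μ) :
    ∀ᵐ m ∂μ, fiberwiseResolvent μ hA hAmeas f m = resolvent (A m) (-Complex.I) (f m) :=
  fiberwise_apply_ae μ _ _ f

/-- Square integrability of m ↦ A(m)R(m)g(m) is automatic, as it equals g(m) - iR(m)g(m). -/
theorem isResolventAt_fiberwiseResolvent :
    IsResolventAt (directIntegral μ A) (-Complex.I) (fiberwiseResolvent μ hA hAmeas) := by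
  constructor
  · intro x
    refine Lp.ext ?_
    have hx := (mem_graph_directIntegral μ A x (directIntegral μ A x)).1
      (LinearPMap.mem_graph _ x)
    filter_upwards [hx, fiberwiseResolvent_apply_ae μ hA hAmeas
      (directIntegral μ A x - (-Complex.I) • (x : Lp H 2 μ)),
      Lp.coeFn_sub (directIntegral μ A x) ((-Complex.I) • (x : Lp H 2 μ)),
      Lp.coeFn_smul (-Complex.I) (x : Lp H 2 μ)] with m ⟨y, hy, hAy⟩ h2 h3 h4
    rw [h2, h3, Pi.sub_apply, h4, Pi.smul_apply, ← hAy, ← hy]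
    exact (isResolventAt_neg_I (hA m)).1 y
  · intro g
    have hgr : (fiberwiseResolvent μ hA hAmeas g,
        g + (-Complex.I) • fiberwiseResolvent μ hA hAmeas g) ∈ (directIntegral μ A).graph := by
      rw [mem_graph_directIntegral]
      filter_upwards [fiberwiseResolvent_apply_ae μ hA hAmeas g,
        Lp.coeFn_add g ((-Complex.I) • fiberwiseResolvent μ hA hAmeas g),
        Lp.coeFn_smul (-Complex.I) (fiberwiseResolvent μ hA hAmeas g)] with m h1 h2 h3
      obtain ⟨x, hx, hAx⟩ := (isResolventAt_neg_I (hA m)).2 (g m)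
      refine ⟨x, hx.trans h1.symm, ?_⟩
      rw [h2, Pi.add_apply, h3, Pi.smul_apply, h1, ← hx, ← hAx]
      abel
    rw [LinearPMap.mem_graph_iff] at hgr
    obtain ⟨x, hx, hAx⟩ := hgr
    refine ⟨x, hx, ?_⟩
    rw [hAx]
    simp only at hx
    rw [hx, add_sub_cancel_right]

/-- If `R = (T - w)⁻¹` and `1 + (w - z) R = (T - z) R` is invertible, then `z` belongs to the
resolvent set of `T`. -/
theorem IsResolventAt.mem_resolventSet_of_isUnit {E : Type*} [NormedAddCommGroup E]
    [NormedSpace ℂ E] {T : E →ₗ.[ℂ] E} {w z : ℂ} {R : E →L[ℂ] E} (hR : IsResolventAt T w R)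
    (hu : IsUnit (1 + (w - z) • R)) : z ∈ resolventSet T := by
  obtain ⟨u, hu⟩ := hu
  have h1 : ∀ y, (↑u⁻¹ : E →L[ℂ] E) (y + (w - z) • R y) = y := fun y => by
    have := congrArg (fun f : E →L[ℂ] E => f y) u.inv_mul
    simpa [hu] using this
  have h2 : ∀ y, (↑u⁻¹ : E →L[ℂ] E) y + (w - z) • R ((↑u⁻¹ : E →L[ℂ] E) y) = y := fun y => by
    have := congrArg (fun f : E →L[ℂ] E => f y) u.mul_inv
    simpa [hu] using this
  refine ⟨R.comp (↑u⁻¹ : E →L[ℂ] E), fun x => ?_, fun y => ?_⟩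
  · have hx := hR.1 x
    have : T x - z • (x : E) = (T x - w • (x : E)) + (w - z) • R (T x - w • (x : E)) := by
      rw [hx]; module
    rw [this, ContinuousLinearMap.comp_apply, h1, hx]
  · obtain ⟨x, hx, hxy⟩ := hR.2 ((↑u⁻¹ : E →L[ℂ] E) y)
    refine ⟨x, hx, ?_⟩
    have : T x - z • (x : E) = (T x - w • (x : E)) + (w - z) • (x : E) := by module
    rw [this, hxy, hx, h2]

/-- If the operators `A(m) - z` are bounded below uniformly in `m`, then `z` belongs to the
resolvent set of their direct integral. -/
theorem mem_resolventSet_directIntegral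
    (hA : ∀ m, IsSelfAdjoint (A m)) (hAmeas : MeasurableFamily A) {z : ℂ} {c : ℝ} (hc : 0 < c)
    (h : ∀ (m : M) (x : (A m).domain), c * ‖(x : H)‖ ≤ ‖A m x - z • (x : H)‖) :
    z ∈ resolventSet (directIntegral μ A) := by
  refine (isResolventAt_fiberwiseResolvent μ hA hAmeas).mem_resolventSet_of_isUnit ?_
  set R := fiberwiseResolvent μ hA hAmeas
  have hN : IsStarNormal R := isStarNormal_fiberwise μ _ _
    fun m => isStarNormal_resolvent_neg_I (hA m)
  have hN2 : IsStarNormal (1 + (-Complex.I - z) • R) := by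
    refine ⟨?_⟩
    rw [star_add, star_smul, star_one]
    exact ((Commute.one_left _).add_left
      (((Commute.one_right _).add_right ((hN.star_comm_self.smul_right _))).smul_left _))
  -- With x = R(m)f(m), f(m) = (A(m) - z)x - (-i - z)x, and ‖x‖ ≤ c⁻¹‖(A(m) - z)x‖.
  have hK : 0 < 1 + ‖-Complex.I - z‖ * c⁻¹ := by positivity
  refine isUnit_of_isStarNormal_of_bounded_below hN2 (inv_pos.2 hK) fun f => ?_
  rw [inv_mul_le_iff₀ hK]
  refine Lp.norm_le_mul_norm_of_ae_le_mul ?_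
  change ∀ᵐ m ∂μ, ‖f m‖ ≤ _ * ‖(f + (-Complex.I - z) • R f) m‖
  filter_upwards [fiberwiseResolvent_apply_ae μ hA hAmeas f,
    Lp.coeFn_add f ((-Complex.I - z) • R f),
    Lp.coeFn_smul (-Complex.I - z) (R f)] with m h1 h2 h3
  rw [h2, Pi.add_apply, h3, Pi.smul_apply, h1]
  obtain ⟨x, hx, hAx⟩ := (isResolventAt_neg_I (hA m)).2 (f m)
  rw [← hx, ← hAx]
  have e1 : A m x - (-Complex.I) • (x : H) + (-Complex.I - z) • (x : H) =
      A m x - z • (x : H) := by module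
  have e2 : A m x - (-Complex.I) • (x : H) =
      (A m x - z • (x : H)) - (-Complex.I - z) • (x : H) := by module
  rw [e1, e2]
  have hx2 : ‖(x : H)‖ ≤ c⁻¹ * ‖A m x - z • (x : H)‖ := by
    rw [inv_mul_eq_div, le_div_iff₀ hc, mul_comm]
    exact h m x
  calc _ ≤ ‖A m x - z • (x : H)‖ + ‖(-Complex.I - z) • (x : H)‖ := norm_sub_le _ _
    _ ≤ ‖A m x - z • (x : H)‖ + ‖-Complex.I - z‖ * (c⁻¹ * ‖A m x - z • (x : H)‖) := by
        rw [norm_smul]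
        gcongr
    _ = _ := by ring

/-- If every neighbourhood of `z` meets the spectra `σ(A(m))` for all `m` in a set containing a
measurable subset of positive finite measure, then `z ∈ σ(∫^⊕ A(m) dμ(m))`. -/
theorem mem_spectrum_directIntegral
    (hA : ∀ m, IsSelfAdjoint (A m)) (hAmeas : MeasurableFamily A) {z : ℂ}
    (h : ∀ ε > 0, ∃ F, MeasurableSet F ∧ 0 < μ F ∧ μ F < ⊤ ∧
      ∀ m ∈ F, ∃ w ∈ spectrum (A m), ‖w - z‖ < ε) :
    z ∈ spectrum (directIntegral μ A) := by
  rintro ⟨S, hS⟩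
  obtain ⟨ε, hε, hεS⟩ : ∃ ε : ℝ, 0 < ε ∧ ‖S‖ * (2 * ε) < 1 :=
    ⟨(4 * (‖S‖ + 1))⁻¹, by positivity, by
      have := norm_nonneg S
      rw [mul_inv, ← mul_assoc, ← mul_assoc, ← div_eq_mul_inv, div_lt_one (by positivity)]
      linarith⟩
  obtain ⟨F, hF, hF0, hFtop, hFs⟩ := h ε hε
  let R : M → H →L[ℂ] H := fun m => resolvent (A m) (-Complex.I)
  -- For x = R(m)v this reads ‖(A(m) - z)x‖ < 2ε‖x‖: one ε for the approximate eigenvector at w, the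
  -- other for |w - z|.
  let P : H → M → Prop := fun v m => ‖v + (-Complex.I - z) • R m v‖ < 2 * ε * ‖R m v‖
  have hP : ∀ v, MeasurableSet {m | P v m} := fun v =>
    measurableSet_lt
      (measurable_norm_of_measurable_inner fun φ => by
        simp only [inner_add_right, inner_smul_right]
        exact measurable_const.add ((hAmeas φ v).const_mul _))
      ((measurable_norm_of_measurable_inner fun φ => hAmeas φ v).const_mul _)
  -- P is open in v, so the dense sequence replaces a measurable selection of eigenvectors.
  have hcover : F ⊆ ⋃ n, F ∩ {m | P (denseSeq H n) m} := by
    intro m hm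
    obtain ⟨w, hw, hwz⟩ := hFs m hm
    obtain ⟨x, hx⟩ := exists_norm_sub_smul_lt (hA m) hw hε
    have hopen : IsOpen {v : H | P v m} :=
      isOpen_lt (by fun_prop) (by fun_prop)
    have hmem : A m x - (-Complex.I) • (x : H) ∈ {v : H | P v m} := by
      change ‖_ + (-Complex.I - z) • R m _‖ < 2 * ε * ‖R m _‖
      rw [(isResolventAt_neg_I (hA m)).1 x]
      have e1 : A m x - (-Complex.I) • (x : H) + (-Complex.I - z) • (x : H) =
        (A m x - w • (x : H)) + (w - z) • (x : H) := by module
      rw [e1]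
      calc _ ≤ ‖A m x - w • (x : H)‖ + ‖(w - z) • (x : H)‖ := norm_add_le _ _
        _ < ε * ‖(x : H)‖ + ε * ‖(x : H)‖ := by
            rw [norm_smul]
            exact add_lt_add_of_lt_of_le hx (by gcongr)
        _ = _ := by ring
    obtain ⟨n, hn⟩ := (denseRange_denseSeq H).exists_mem_open hopen ⟨_, hmem⟩
    exact Set.mem_iUnion.2 ⟨n, hm, hn⟩
  obtain ⟨n, hn⟩ : ∃ n, 0 < μ (F ∩ {m | P (denseSeq H n) m}) := by
    by_contra! hcon
    refine hF0.ne' (measure_mono_null hcover (measure_iUnion_null fun n => ?_))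
    exact le_antisymm (hcon n) bot_le
  set v := denseSeq H n
  have hGm : MeasurableSet (F ∩ {m | P v m}) := hF.inter (hP v)
  have hGtop : μ (F ∩ {m | P v m}) ≠ ⊤ :=
    ((measure_mono Set.inter_subset_left).trans_lt hFtop).ne
  set G := F ∩ {m | P v m}
  let g : Lp H 2 μ := indicatorConstLp 2 hGm hGtop v
  have hg1 : ∀ᵐ m ∂μ, m ∈ G → g m = v := indicatorConstLp_coeFn_mem
  have hg2 : ∀ᵐ m ∂μ, m ∉ G → g m = 0 := indicatorConstLp_coeFn_notMem
  obtain ⟨x, hx, hxg⟩ := (isResolventAt_fiberwiseResolvent μ hA hAmeas).2 g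
  have hxR : ∀ᵐ m ∂μ, (x : Lp H 2 μ) m = R m (g m) := by
    rw [hx]
    exact fiberwiseResolvent_apply_ae μ hA hAmeas g
  have hbound : ‖directIntegral μ A x - z • (x : Lp H 2 μ)‖ ≤ 2 * ε * ‖(x : Lp H 2 μ)‖ := by
    have e1 : directIntegral μ A x - z • (x : Lp H 2 μ) =
        g + (-Complex.I - z) • (x : Lp H 2 μ) := by
      rw [← hxg]; module
    rw [e1]
    refine Lp.norm_le_mul_norm_of_ae_le_mul ?_
    filter_upwards [hg1, hg2, hxR, Lp.coeFn_add g ((-Complex.I - z) • (x : Lp H 2 μ)),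
      Lp.coeFn_smul (-Complex.I - z) (x : Lp H 2 μ)] with m h1 h2 h3 h4 h5
    rw [h4, Pi.add_apply, h5, Pi.smul_apply, h3]
    by_cases hm : m ∈ G
    · rw [h1 hm]
      exact le_of_lt hm.2
    · rw [h2 hm]
      simp
  -- The choice ‖S‖ · 2ε < 1 contradicts the approximate eigenvector estimate unless x = 0.
  have hx0 : (x : Lp H 2 μ) = 0 := by
    have h1 : ‖(x : Lp H 2 μ)‖ ≤ ‖S‖ * (2 * ε * ‖(x : Lp H 2 μ)‖) := by
      conv_lhs => rw [← hS.1 x]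
      exact S.le_opNorm_of_le hbound
    have h2 := norm_nonneg (x : Lp H 2 μ)
    exact norm_eq_zero.1 (by nlinarith)
  -- If x = 0 then R(m)v = 0 for almost every m in G, where the strict inequality P would read ‖v‖ <
  -- 0.
  have hG0 : μ G = 0 := by
    rw [measure_eq_zero_iff_ae_notMem]
    filter_upwards [hg1, hxR, Lp.coeFn_zero H 2 μ] with m h1 h2 h3 hm
    rw [hx0, h3, h1 hm] at h2
    have h4 : P v m := hm.2
    have h5 : R m v = 0 := h2.symm
    simp only [P, h5, norm_zero, mul_zero] at h4
    exact absurd h4 (not_lt.2 (norm_nonneg _))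
  exact hn.ne' hG0

end Spectrum

/-! ### Consequences of Hausdorff continuity of the spectra -/

section Continuity

variable {H : Type*} [NormedAddCommGroup H] [InnerProductSpace ℂ H] [CompleteSpace H]
  {M : Type*} [TopologicalSpace M] {A : M → H →ₗ.[ℂ] H}

/-- A point of the complement of all the spectra has a uniform positive distance to them. -/
theorem exists_forall_le_abs_sub_of_continuous_realSpectrum [CompactSpace M]
    (hcont : Continuous fun m => realSpectrum (A m)) {l : ℝ}
    (hl : ∀ m, (l : ℂ) ∉ spectrum (A m)) :
    ∃ d : ℝ, 0 < d ∧ ∀ (m : M) (s : ℝ), (s : ℂ) ∈ spectrum (A m) → d ≤ |s - l| := by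
  rcases isEmpty_or_nonempty M with hM | hM
  · exact ⟨1, one_pos, fun m => isEmptyElim m⟩
  have hc : Continuous fun m => Metric.infEDist l (realSpectrum (A m) : Set ℝ) :=
    Closeds.continuous_infEDist.comp (continuous_const.prodMk hcont)
  obtain ⟨m₀, -, hm₀⟩ := isCompact_univ.exists_isMinOn Set.univ_nonempty hc.continuousOn
  have hpos : 0 < Metric.infEDist l (realSpectrum (A m₀) : Set ℝ) := by
    rw [pos_iff_ne_zero]
    intro h0
    exact hl m₀ ((Metric.mem_iff_infEDist_zero_of_closed (realSpectrum (A m₀)).isClosed).2 h0)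
  -- The minimal distance may be ∞ (empty spectrum), so a finite d below it is taken.
  obtain ⟨d, hd0, hd⟩ := ENNReal.lt_iff_exists_nnreal_btwn.1 hpos
  refine ⟨d, by exact_mod_cast hd0, fun m s hs => ?_⟩
  have h1 : (d : ENNReal) ≤ edist l s :=
    (hd.le.trans (hm₀ (Set.mem_univ m))).trans (Metric.infEDist_le_edist_of_mem hs)
  rw [edist_nndist, ENNReal.coe_le_coe, ← NNReal.coe_le_coe, coe_nndist, Real.dist_eq,
    abs_sub_comm] at h1
  exact h1

/-- The distance from l to the spectrum is continuous in m and vanishes at m₀. -/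
theorem exists_isOpen_forall_exists_mem_spectrum
    (hcont : Continuous fun m => realSpectrum (A m)) {m₀ : M} {l : ℝ}
    (hl : (l : ℂ) ∈ spectrum (A m₀)) {ε : ℝ} (hε : 0 < ε) :
    ∃ U : Set M, IsOpen U ∧ m₀ ∈ U ∧ ∀ m ∈ U, ∃ w ∈ spectrum (A m), ‖w - (l : ℂ)‖ < ε := by
  have hc : Continuous fun m => Metric.infEDist l (realSpectrum (A m) : Set ℝ) :=
    Closeds.continuous_infEDist.comp (continuous_const.prodMk hcont)
  refine ⟨{m | Metric.infEDist l (realSpectrum (A m) : Set ℝ) < ENNReal.ofReal ε},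
    isOpen_lt hc continuous_const, ?_, fun m hm => ?_⟩
  · change Metric.infEDist l (realSpectrum (A m₀) : Set ℝ) < _
    rw [Metric.infEDist_zero_of_mem (show l ∈ (realSpectrum (A m₀) : Set ℝ) from hl)]
    exact ENNReal.ofReal_pos.2 hε
  · obtain ⟨s, hs, hsl⟩ := Metric.infEDist_lt_iff.1 hm
    refine ⟨s, hs, ?_⟩
    rw [edist_dist, ENNReal.ofReal_lt_ofReal_iff hε, dist_comm, Real.dist_eq] at hsl
    rwa [← Complex.ofReal_sub, Complex.norm_real]

end Continuity

end FibredOperator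

end

/-! ### The two inclusions -/

open FibredOperator in
/-- The spectrum of a direct integral of self-adjoint operators over a compact space with spectra
depending continuously on the base point is the union of the spectra of the fibres. -/
theorem proposition2p2
    {H : Type*} [NormedAddCommGroup H] [InnerProductSpace ℂ H] [CompleteSpace H]
    [SeparableSpace H]
    {M : Type*} [TopologicalSpace M] [CompactSpace M] [MeasurableSpace M] [BorelSpace M]
    (μ : Measure M)
    (hμ : ∀ U : Set M, IsOpen U → U.Nonempty →
      ∃ F ⊆ U, MeasurableSet F ∧ 0 < μ F ∧ μ F < ⊤)
    (A : M → H →ₗ.[ℂ] H)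
    (hA : ∀ m, IsSelfAdjoint (A m))
    (hAmeas : FibredOperator.MeasurableFamily A)
    (hcont : Continuous fun m => FibredOperator.realSpectrum (A m)) :
    FibredOperator.spectrum (FibredOperator.directIntegral μ A) =
      ⋃ m, FibredOperator.spectrum (A m) := by
  ext z
  rw [Set.mem_iUnion]
  constructor
  · intro hz
    by_contra! hcon
    have hcon' : ∀ m, z ∈ resolventSet (A m) := fun m => not_not.1 (hcon m)
    refine hz ?_
    by_cases him : z.im = 0
    · obtain ⟨l, rfl⟩ : ∃ l : ℝ, (l : ℂ) = z := ⟨z.re, Complex.ext rfl him.symm⟩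
      obtain ⟨d, hd, hdist⟩ := exists_forall_le_abs_sub_of_continuous_realSpectrum hcont hcon
      exact mem_resolventSet_directIntegral μ hA hAmeas hd fun m =>
        mul_norm_le_of_forall_le_abs_sub (hA m) hd (hcon' m) (hdist m)
    · exact mem_resolventSet_directIntegral μ hA hAmeas (abs_pos.2 him) fun m =>
        abs_im_mul_norm_le (hA m) z
  · rintro ⟨m₀, hz⟩
    have him : z.im = 0 := by
      by_contra him
      exact hz (mem_resolventSet_of_im_ne_zero (hA m₀) him)
    obtain ⟨l, rfl⟩ : ∃ l : ℝ, (l : ℂ) = z := ⟨z.re, Complex.ext rfl him.symm⟩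
    refine mem_spectrum_directIntegral μ hA hAmeas fun ε hε => ?_
    obtain ⟨U, hU, hm₀, hUs⟩ := exists_isOpen_forall_exists_mem_spectrum hcont hz hε
    obtain ⟨F, hFU, hF, hF0, hFtop⟩ := hμ U hU ⟨m₀, hm₀⟩
    exact ⟨F, hF, hF0, hFtop, fun m hm => hUs m (hFU hm)⟩
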